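/- **Theorem (Completeness for FOJT45).** Let $\mathcal{CS}$ be a variant closed and axiomatically appropriate constant specification. For every closed formula $\varphi$, if $\varphi$ is valid in every Fitting model for FOJT45 meeting $\mathcal{CS}$, then $\varphi$ is provable in $\mathrm{FOJT45}_{\mathcal{CS}}$. *Language.* Justification terms: $t ::= p_i \mid c_i \mid (t\cdot t)\mid (t+t)\mid\, !t \mid\, ?t \mid \mathsf{gen}_x(t)$ ($i\in\mathbb N$, $x$ an individual variable). Formulas: $\varphi ::= Px_1\dots x_n \mid \bot \mid (\varphi\to\varphi)\mid \forall x\varphi \mid t{:}_X\varphi$, with $X$ a finite set of individual variables; there are countably many individual variables and countably many predicate symbols of each arity. Here $\neg\varphi$ is $\varphi\to\bot$ and $t{:}\varphi$ is $t{:}_\emptyset\varphi$. Free variables are as usual, with $\mathrm{fv}(t{:}_X\varphi)=X$; the free occurrences in $t{:}_X\varphi$ are those in $X$ and those free in $\varphi$ of variables in $X$. A variable $y$ is free for $x$ in $\varphi$ if no free occurrence of $x$ in $\varphi$ lies in the scope of a $\forall y$, or in a subformula $t{:}_X\psi$ with $y\in \mathrm{fv}(\psi)$ and $y\notin X$. A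 formula is closed if it has no free variables. *Axioms of FOJT45.* A1: instances of propositional tautologies; $\forall x\varphi\to\varphi(y/x)$ with $y$ free for $x$ in $\varphi$; $\forall x(\varphi\to\psi)\to(\varphi\to\forall x\psi)$ with $x\notin\mathrm{fv}(\varphi)$. A2: $t{:}_{X\cup\{y\}}\varphi\to t{:}_X\varphi$ with $y\notin X\cup\mathrm{fv}(\varphi)$. A3: $t{:}_X\varphi\to t{:}_{X\cup\{y\}}\varphi$ with $y\notin X$. B1: $t{:}_X\varphi\to\varphi$. B2: $t{:}_X(\varphi\to\psi)\to(s{:}_X\varphi\to[t\cdot s]{:}_X\psi)$. B3: $t{:}_X\varphi\to[t+s]{:}_X\varphi$ and $s{:}_X\varphi\to[t+s]{:}_X\varphi$. B4: $t{:}_X\varphi\to\, !t{:}_Xt{:}_X\varphi$. B5: $t{:}_X\varphi\to\mathsf{gen}_x(t){:}_X\forall x\varphi$ with $x\notin X$. B6: $\neg t{:}_X\varphi\to\, ?t{:}_X\neg t{:}_X\varphi$. The rules are modus ponens and generalization ($\varphi$ / $\forall x\varphi$). *Constant specifications.* A constant specification is a set $\mathcal{CS}$ of formulas of the form $c{:}\psi$,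 with $c$ a constant and $\psi$ an axiom. It is axiomatically appropriate if for each axiom $\psi$ there is a constant $c$ with $c{:}\psi\in\mathcal{CS}$. The formulas provable in $\mathrm{FOJT45}_{\mathcal{CS}}$ are those derivable by the rules from the axioms and the members of $\mathcal{CS}$. Two formulas are variable variants if each can be turned into the other by a one-to-one renaming of its free variables in which no renamed variable and no new name occurs otherwise than free in the formula, i.e. occurs quantified, as a subscript of $\mathsf{gen}$, or free in $\psi$ but not in $X$ for some subformula $t{:}_X\psi$. $\mathcal{CS}$ is variant closed if, for all constants $c$ and variable variants $\varphi,\psi$, $c{:}\varphi\in\mathcal{CS}$ iff $c{:}\psi\in\mathcal{CS}$. *Models.* For a nonempty set $\mathcal D$, a $\mathcal D$-formula is obtained from a formula by replacing some of its free variables by members of $\mathcal D$; it is closed if it has no free individual variable. A Fitting model for FOJT45 is $\mathcal M=\langle\mathcal W,\mathcal R,\mathcal D,\mathcal I,\mathcal E\rangle$ with $\mathcal W,\mathcal D$ nonempty sets, $\mathcal R$ an equivalence relation on $\mathcal W$, $\mathcal I(P,w)\subseteq\mathcal D^n$ for each $n$-ary $P$ and $w\in\mathcal W$, and $\mathcal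 E(t,\varphi)\subseteq\mathcal W$ for each term $t$ and $\mathcal D$-formula $\varphi$. Truth of closed $\mathcal D$-formulas at $w$ is defined by: $P(\vec a)$ is true at $w$ iff $\vec a\in\mathcal I(P,w)$; the usual clauses for $\bot$, $\to$; $\forall x\psi(x)$ is true at $w$ iff $\psi(a)$ is true at $w$ for all $a\in\mathcal D$; $t{:}_X\psi(\vec x)$, where $\vec x$ are all the free variables of $\psi$, is true at $w$ iff $w\in\mathcal E(t,\psi)$ and, for every $w'$ with $w\mathcal Rw'$ and every $\vec a\in\mathcal D$, $\psi(\vec a)$ is true at $w'$. It is required that, for all terms $t,s$ and $\mathcal D$-formulas $\varphi,\psi$: * $\mathcal E(t,\varphi\to\psi)\cap\mathcal E(s,\varphi)\subseteq\mathcal E([t\cdot s],\psi)$; * $\mathcal E(s,\varphi)\cup\mathcal E(t,\varphi)\subseteq\mathcal E([s+t],\varphi)$; * $\mathcal E(t,\varphi)\subseteq\mathcal E(!t,t{:}_X\varphi)$ for every finite $X\subseteq\mathcal D$ containing the members of $\mathcal D$ occurring in $\varphi$; * if $w\in\mathcal E(t,\varphi)$ and $w\mathcal Rw'$ then $w'\in\mathcal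 E(t,\varphi)$; * $\mathcal E(t,\varphi(x))\subseteq\mathcal E(t,\varphi(a))$ for every variable $x$ and $a\in\mathcal D$; * $\mathcal E(t,\varphi)\subseteq\mathcal E(\mathsf{gen}_x(t),\forall x\varphi)$ for every variable $x$; * (strong evidence) $t{:}_X\varphi$ is true at every $w\in\mathcal E(t,\varphi)$, where $X$ is the set of members of $\mathcal D$ occurring in $\varphi$; * ($?$ condition) $\mathcal W\setminus\mathcal E(t,\varphi)\subseteq\mathcal E(?t,\neg t{:}_X\varphi)$, with $X$ as in the previous item. $\mathcal M$ meets $\mathcal{CS}$ if $\mathcal E(c,\varphi)=\mathcal W$ whenever $c{:}\varphi\in\mathcal{CS}$. A closed formula is valid in $\mathcal M$ if it is true at every $w\in\mathcal W$. -/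

import Mathlib

namespace FOJT45

/-- Justification terms: variables `p_i`, constants `c_i`, `t · s`, `t + s`, `!t`, `?t`, `gen_x(t)`.
There is no primitive `b`. -/
inductive JTerm : Type where
  | var (i : ℕ) : JTerm
  | const (i : ℕ) : JTerm
  | app (t s : JTerm) : JTerm
  | sum (t s : JTerm) : JTerm
  | bang (t : JTerm) : JTerm
  | query (t : JTerm) : JTerm
  | gen (x : ℕ) (t : JTerm) : JTerm

/-- The variables occurring as subscripts of `gen` in a term. -/
def JTerm.genVars : JTerm → Set ℕ
  | var _ => ∅
  | const _ => ∅
  | app t s => t.genVars ∪ s.genVars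
  | sum t s => t.genVars ∪ s.genVars
  | bang t => t.genVars
  | query t => t.genVars
  | gen x t => {x} ∪ t.genVars

/-- Formulas whose argument places and subscripts may hold individual variables `x_i`
(`Sum.inl i`) or elements of `D` (`Sum.inr d`); elements of `D` are never quantified.
`atom n P args` applies the `P`-th `n`-ary predicate symbol, `box t X φ` is `t :_X φ`. -/
inductive Formula (D : Type) : Type where
  | atom (n : ℕ) (P : ℕ) (args : Fin n → ℕ ⊕ D) : Formula D
  | bot : Formula D
  | imp (φ ψ : Formula D) : Formula D
  | all (x : ℕ) (φ : Formula D) : Formula D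
  | box (t : JTerm) (X : Finset (ℕ ⊕ D)) (φ : Formula D) : Formula D

/-- Formulas of the (basic) language, without domain elements. -/
abbrev Fml : Type := Formula Empty

namespace Formula

variable {D : Type}

/-- `¬ φ` -/
def neg (φ : Formula D) : Formula D := imp φ bot

/-- Free variables, together with the domain elements occurring freely.
The free occurrences of `t :_X φ` are exactly those in `X`. -/
noncomputable def fv : Formula D → Finset (ℕ ⊕ D)
  | atom _ _ args => open scoped Classical in Finset.univ.image args
  | bot => ∅
  | imp φ ψ => open scoped Classical in φ.fv ∪ ψ.fv
  | all x φ => open scoped Classical in φ.fv.erase (Sum.inl x)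
  | box _ X _ => X

/-- The variables having nonfree occurrences: those that are quantified, those that are subscripts
of `gen`, and, for subformulas `t :_X ψ`, those free in `ψ` without belonging to `X`. -/
def nonfree : Formula D → Set ℕ
  | atom _ _ _ => ∅
  | bot => ∅
  | imp φ ψ => φ.nonfree ∪ ψ.nonfree
  | all x φ => {x} ∪ φ.nonfree
  | box t X φ => t.genVars ∪ φ.nonfree ∪ {x | Sum.inl x ∈ φ.fv ∧ Sum.inl x ∉ X}

/-- The set of domain elements occurring in a formula (as a subscript set); for `D`-formulas in
the sense of `WF` all occurrences of domain elements are free. -/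
noncomputable def consts (φ : Formula D) : Finset (ℕ ⊕ D) := φ.fv.filter (fun v => v.isRight)

/-- `D`-formulas are those obtained from formulas by putting domain elements in place of *free*
occurrences of variables: in every subformula `t :_X φ`, the domain elements of `φ` are in `X`. -/
def WF : Formula D → Prop
  | atom _ _ _ => True
  | bot => True
  | imp φ ψ => φ.WF ∧ ψ.WF
  | all _ φ => φ.WF
  | box _ X φ => φ.WF ∧ φ.consts ⊆ X

/-- No individual variable is free (domain elements may occur). -/
def IsClosed (φ : Formula D) : Prop := ∀ x : ℕ, Sum.inl x ∉ φ.fv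

/-- The substitution of `v` for the variable `x` alone. -/
def single (x : ℕ) (v : ℕ ⊕ D) : ℕ → ℕ ⊕ D := Function.update Sum.inl x v

/-- `s` on the variables in `X`, the identity on the others. -/
noncomputable def restrict (s : ℕ → ℕ ⊕ D) (X : Finset (ℕ ⊕ D)) : ℕ → ℕ ⊕ D :=
  fun x => open scoped Classical in if Sum.inl x ∈ X then s x else Sum.inl x

/-- Simultaneous replacement of the free occurrences of every variable `x` by `s x`. -/
noncomputable def subst : (ℕ → ℕ ⊕ D) → Formula D → Formula D
  | s, atom n P args => atom n P (fun i => Sum.elim s Sum.inr (args i))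
  | _, bot => bot
  | s, imp φ ψ => imp (subst s φ) (subst s ψ)
  | s, all x φ => all x (subst (Function.update s x (Sum.inl x)) φ)
  | s, box t X φ =>
      open scoped Classical in
      box t (X.image (Sum.elim s Sum.inr)) (subst (restrict s X) φ)

/-- `s x` is free for `x`, for all free variables `x`: no replacing variable is captured by a
quantifier, and in `t :_X φ` a replacing variable that is free in `φ` belongs to `X`. -/
def FreeFor : (ℕ → ℕ ⊕ D) → Formula D → Prop
  | _, atom _ _ _ => True
  | _, bot => True
  | s, imp φ ψ => FreeFor s φ ∧ FreeFor s ψ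
  | s, all z φ => FreeFor (Function.update s z (Sum.inl z)) φ ∧
      ∀ x : ℕ, Sum.inl x ∈ φ.fv → x ≠ z → s x ≠ Sum.inl z
  | s, box _ X φ => FreeFor (restrict s X) φ ∧
      ∀ x : ℕ, Sum.inl x ∈ X → s x ∈ φ.fv → s x ∈ X

/-- Change of the domain elements; with `f = Empty.elim` the inclusion of formulas into
`D`-formulas. -/
noncomputable def mapD {D' : Type} (f : D → D') : Formula D → Formula D'
  | atom n P args => atom n P (fun i => Sum.map id f (args i))
  | bot => bot
  | imp φ ψ => imp (mapD f φ) (mapD f ψ)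
  | all x φ => all x (mapD f φ)
  | box t X φ => open scoped Classical in box t (X.image (Sum.map id f)) (mapD f φ)

/-- Instances of propositional tautologies. -/
def IsTautology (φ : Formula D) : Prop :=
  ∀ v : Formula D → Prop, ¬ v bot → (∀ α β, v (imp α β) ↔ (v α → v β)) → v φ

/-- The number of connectives, quantifiers and modalities. -/
def size : Formula D → ℕ
  | atom _ _ _ => 0
  | bot => 0
  | imp φ ψ => φ.size + ψ.size + 1
  | all _ φ => φ.size + 1
  | box _ _ φ => φ.size + 1

theorem size_subst (φ : Formula D) (s : ℕ → ℕ ⊕ D) : (subst s φ).size = φ.size := by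
  induction φ generalizing s with
  | atom n P args => rfl
  | bot => rfl
  | imp φ ψ h1 h2 => simp [subst, size, h1, h2]
  | all x φ h => simp [subst, size, h]
  | box t X φ h => simp [subst, size, h]

end Formula

open Formula in
/-- The axiom schemes of first-order `JT45`. -/
inductive Ax {D : Type} : Formula D → Prop where
  -- A1, classical first-order logic
  | taut {φ : Formula D} : IsTautology φ → Ax φ
  | allElim (x : ℕ) (v : ℕ ⊕ D) (φ : Formula D) : FreeFor (single x v) φ →
      Ax (imp (all x φ) (subst (single x v) φ))
  | allImp (x : ℕ) (φ ψ : Formula D) : Sum.inl x ∉ φ.fv →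
      Ax (imp (all x (imp φ ψ)) (imp φ (all x ψ)))
  | a2 (t : JTerm) (X : Finset (ℕ ⊕ D)) (y : ℕ ⊕ D) (φ : Formula D) : y ∉ X → y ∉ φ.fv →
      Ax (imp (box t (open scoped Classical in insert y X) φ) (box t X φ))
  | a3 (t : JTerm) (X : Finset (ℕ ⊕ D)) (y : ℕ ⊕ D) (φ : Formula D) : y ∉ X →
      Ax (imp (box t X φ) (box t (open scoped Classical in insert y X) φ))
  | b1 (t : JTerm) (X : Finset (ℕ ⊕ D)) (φ : Formula D) :
      Ax (imp (box t X φ) φ)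
  | b2 (t s : JTerm) (X : Finset (ℕ ⊕ D)) (φ ψ : Formula D) :
      Ax (imp (box t X (imp φ ψ)) (imp (box s X φ) (box (t.app s) X ψ)))
  | b3l (t s : JTerm) (X : Finset (ℕ ⊕ D)) (φ : Formula D) :
      Ax (imp (box t X φ) (box (t.sum s) X φ))
  | b3r (t s : JTerm) (X : Finset (ℕ ⊕ D)) (φ : Formula D) :
      Ax (imp (box s X φ) (box (t.sum s) X φ))
  | b4 (t : JTerm) (X : Finset (ℕ ⊕ D)) (φ : Formula D) :
      Ax (imp (box t X φ) (box t.bang X (box t X φ)))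
  | b5 (t : JTerm) (X : Finset (ℕ ⊕ D)) (x : ℕ) (φ : Formula D) : Sum.inl x ∉ X →
      Ax (imp (box t X φ) (box (t.gen x) X (all x φ)))
  | b6 (t : JTerm) (X : Finset (ℕ ⊕ D)) (φ : Formula D) :
      Ax (imp (neg (box t X φ)) (box t.query X (neg (box t X φ))))

/-- Every member of `CS` is `c : ψ` with `c` a constant and `ψ` an axiom. -/
def IsConstantSpecification (CS : Set Fml) : Prop :=
  ∀ χ ∈ CS, ∃ (c : ℕ) (ψ : Fml), Ax ψ ∧ χ = Formula.box (JTerm.const c) ∅ ψ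

/-- Every axiom has a constant. -/
def AxiomaticallyAppropriate (CS : Set Fml) : Prop :=
  ∀ ψ : Fml, Ax ψ → ∃ c : ℕ, Formula.box (JTerm.const c) ∅ ψ ∈ CS

/-- `ψ` results from `φ` by a 1-1 renaming of the free variables. Variables with nonfree
occurrences are not concerned: they are neither renamed nor used as new names. -/
def IsRenaming (φ ψ : Fml) : Prop :=
  ∃ f : ℕ → ℕ, Set.InjOn f {x | Sum.inl x ∈ φ.fv} ∧
    (∀ x : ℕ, Sum.inl x ∈ φ.fv → f x ≠ x → x ∉ φ.nonfree ∧ f x ∉ φ.nonfree) ∧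
    ψ = Formula.subst (fun x => Sum.inl (f x)) φ

/-- Variable variants: each can be turned into the other by renaming free variables. -/
def VariableVariants (φ ψ : Fml) : Prop := IsRenaming φ ψ ∧ IsRenaming ψ φ

def VariantClosed (CS : Set Fml) : Prop :=
  ∀ (c : ℕ) (φ ψ : Fml), VariableVariants φ ψ →
    (Formula.box (JTerm.const c) ∅ φ ∈ CS ↔ Formula.box (JTerm.const c) ∅ ψ ∈ CS)

/-- Provability in first-order `JT45` with constant specification `CS`. -/
inductive Provable (CS : Set Fml) : Fml → Prop where
  | ax {φ : Fml} : Ax φ → Provable CS φ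
  | cs {φ : Fml} : φ ∈ CS → Provable CS φ
  | mp {φ ψ : Fml} : Provable CS φ → Provable CS (Formula.imp φ ψ) → Provable CS ψ
  | gen (x : ℕ) {φ : Fml} : Provable CS φ → Provable CS (Formula.all x φ)

/-- The constituents of a constant domain Fitting model: worlds, accessibility, domain,
interpretation, evidence. Only the values of `E` at `D`-formulas (`Formula.WF`) are used. -/
structure FittingModel where
  W : Type
  D : Type
  nonempty_W : Nonempty W
  nonempty_D : Nonempty D
  R : W → W → Prop
  I : (n : ℕ) → ℕ → W → Set (Fin n → D)
  E : JTerm → Formula D → Set W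

namespace FittingModel

open Formula

/-- Truth of a closed `D`-formula at a world. -/
def Truth (M : FittingModel) (w : M.W) : Formula M.D → Prop
  | atom n P args => ∃ d : Fin n → M.D, (args = fun i => Sum.inr (d i)) ∧ d ∈ M.I n P w
  | bot => False
  | imp φ ψ => M.Truth w φ → M.Truth w ψ
  | all x φ => ∀ a : M.D, M.Truth w (subst (single x (Sum.inr a)) φ)
  | box t _ φ => w ∈ M.E t φ ∧
      ∀ w' : M.W, M.R w w' → ∀ a : ℕ → M.D, M.Truth w' (subst (fun x => Sum.inr (a x)) φ)
termination_by φ => φ.size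
decreasing_by all_goals simp only [size_subst, size]; omega

/-- Truth at all worlds, for closed formulas of the basic language. -/
def Valid (M : FittingModel) (φ : Fml) : Prop :=
  ∀ w : M.W, M.Truth w (mapD Empty.elim φ)

/-- The general conditions on evidence functions. -/
structure EvidenceConditions (M : FittingModel) : Prop where
  app : ∀ (t s : JTerm) (φ ψ : Formula M.D), φ.WF → ψ.WF →
    M.E t (imp φ ψ) ∩ M.E s φ ⊆ M.E (t.app s) ψ
  sum : ∀ (t s : JTerm) (φ : Formula M.D), φ.WF → M.E s φ ∪ M.E t φ ⊆ M.E (s.sum t) φ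
  bang : ∀ (t : JTerm) (φ : Formula M.D) (X : Finset (ℕ ⊕ M.D)), φ.WF →
    (∀ v ∈ X, v.isRight) → φ.consts ⊆ X → M.E t φ ⊆ M.E t.bang (box t X φ)
  closure : ∀ (t : JTerm) (φ : Formula M.D) (w w' : M.W), φ.WF →
    w ∈ M.E t φ → M.R w w' → w' ∈ M.E t φ
  inst : ∀ (t : JTerm) (φ : Formula M.D) (x : ℕ) (a : M.D), φ.WF →
    M.E t φ ⊆ M.E t (subst (single x (Sum.inr a)) φ)
  gen : ∀ (t : JTerm) (φ : Formula M.D) (x : ℕ), φ.WF → M.E t φ ⊆ M.E (t.gen x) (all x φ)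

def StrongEvidence (M : FittingModel) : Prop :=
  ∀ (t : JTerm) (φ : Formula M.D), φ.WF → M.E t φ ⊆ {w | M.Truth w (box t φ.consts φ)}

def QueryCondition (M : FittingModel) : Prop :=
  ∀ (t : JTerm) (φ : Formula M.D), φ.WF →
    (M.E t φ)ᶜ ⊆ M.E t.query (neg (box t φ.consts φ))

/-- Fitting models for first-order `JT45`. -/
structure IsFOJT45 (M : FittingModel) : Prop where
  equivalence : Equivalence M.R
  evidence : M.EvidenceConditions
  strong : M.StrongEvidence
  query : M.QueryCondition

def Meets (M : FittingModel) (CS : Set Fml) : Prop :=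
  ∀ (c : ℕ) (φ : Fml), box (JTerm.const c) ∅ φ ∈ CS →
    M.E (JTerm.const c) (mapD Empty.elim φ) = Set.univ

end FittingModel

end FOJT45

/-! Suppose φ is not provable. A Henkin construction puts ¬φ into a maximal consistent set Γ of
formulas with natural numbers as domain elements, and Γ is read as a model with a single world
(`canonicalModel`): t is evidence for α iff t:_X α ∈ Γ, with X the domain elements of α. One world
suffices because the truth clause of t:_X α asks for evidence besides truth of the instances, and
evidence alone already says that the formula lies in Γ. Truth of the instances is then automatic: by
A3, generalization and instantiation, evidence for α(x) is evidence for each α(a)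
(`box_subst_single_mem`), and B1 turns it into membership of all closed instances (`subst_inr_mem`).
So truth is membership in Γ (`truth_canonicalModel`), and the remaining conditions on evidence come
from B2–B6.

Derivability with domain elements is reduced to the basic calculus. `enc n` reads d as the variable
d + n, and `DProv` asks for provability for all large n. Once n exceeds the variables involved this
is an injective renaming, so axioms go to axioms (`Ax.enc`), and formulas without domain elements,
such as members of CS, stay fixed; no derivation is ever renamed. A fresh domain element becomes a
fresh variable, over which one may generalize (`DProv.all_of_fresh`); this keeps the Henkin
witnesses consistent (`exists_consistent_step`). -/

namespace FOJT45

namespace Formula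

/-! ### Occurrences of variables and domain elements -/

variable {D D' : Type}

/-- All variables and domain elements occurring in a formula, except as subscripts of `gen`. -/
def occ : Formula D → Set (ℕ ⊕ D)
  | atom _ _ args => Set.range args
  | bot => ∅
  | imp φ ψ => φ.occ ∪ ψ.occ
  | all x φ => {Sum.inl x} ∪ φ.occ
  | box _ X φ => X ∪ φ.occ

theorem finite_occ (φ : Formula D) : φ.occ.Finite := by
  induction φ with
  | atom n P args => exact Set.finite_range args
  | bot => exact Set.finite_empty
  | imp φ ψ h1 h2 => exact h1.union h2
  | all x φ h => exact (Set.finite_singleton _).union h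
  | box t X φ h => exact X.finite_toSet.union h

theorem fv_subset_occ (φ : Formula D) : (φ.fv : Set (ℕ ⊕ D)) ⊆ φ.occ := by
  induction φ with
  | atom n P args => simp [fv, occ]
  | bot => simp [fv, occ]
  | imp φ ψ h1 h2 =>
      simp only [fv, occ, Finset.coe_union]
      exact Set.union_subset_union h1 h2
  | all x φ h =>
      intro v hv
      simp only [fv, Finset.mem_coe, Finset.mem_erase] at hv
      exact Or.inr (h hv.2)
  | box t X φ h => exact Set.subset_union_left

theorem mem_occ_of_mem_fv {φ : Formula D} {v : ℕ ⊕ D} (h : v ∈ φ.fv) : v ∈ φ.occ :=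
  fv_subset_occ φ h

theorem mem_consts {φ : Formula D} {v : ℕ ⊕ D} : v ∈ φ.consts ↔ v ∈ φ.fv ∧ v.isRight := by
  simp [consts]

theorem inr_mem_consts {φ : Formula D} {d : D} : Sum.inr d ∈ φ.consts ↔ Sum.inr d ∈ φ.fv := by
  simp [consts]

/-! ### Substitution for a single variable -/

theorem single_self (x : ℕ) (v : ℕ ⊕ D) : single x v x = v := Function.update_self ..

theorem single_of_ne {x y : ℕ} (h : y ≠ x) (v : ℕ ⊕ D) : single x v y = Sum.inl y :=
  Function.update_of_ne h ..

theorem update_single_self (x : ℕ) (v : ℕ ⊕ D) :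
    Function.update (single x v) x (Sum.inl x) = Sum.inl := by
  simp [single]

theorem update_single_of_ne {x z : ℕ} (h : z ≠ x) (v : ℕ ⊕ D) :
    Function.update (single x v) z (Sum.inl z) = single x v := by
  rw [← single_of_ne h v, Function.update_eq_self]

theorem restrict_single_of_mem {x : ℕ} {X : Finset (ℕ ⊕ D)} (h : Sum.inl x ∈ X) (v : ℕ ⊕ D) :
    restrict (single x v) X = single x v := by
  funext y
  by_cases hy : y = x
  · subst hy; simp [restrict, h]
  · simp [restrict, single_of_ne hy]

theorem elim_single {x : ℕ} {u : ℕ ⊕ D} (h : u ≠ Sum.inl x) (v : ℕ ⊕ D) :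
    Sum.elim (single x v) Sum.inr u = u := by
  rcases u with y | d
  · exact single_of_ne (fun e => h (by rw [e])) v
  · rfl

theorem subst_eq_self {φ : Formula D} {s : ℕ → ℕ ⊕ D}
    (h : ∀ x : ℕ, Sum.inl x ∈ φ.fv → s x = Sum.inl x) : subst s φ = φ := by
  classical
  induction φ generalizing s with
  | atom n P args =>
      simp only [subst, atom.injEq, heq_eq_eq, true_and]
      funext i
      rcases hi : args i with x | d
      · exact h x (by simp only [fv, Finset.mem_image]; exact ⟨i, Finset.mem_univ _, hi⟩)
      · rfl
  | bot => rfl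
  | imp φ ψ h1 h2 =>
      simp only [fv, Finset.mem_union] at h
      rw [subst, h1 fun x hx => h x (Or.inl hx), h2 fun x hx => h x (Or.inr hx)]
  | all z φ ih =>
      rw [subst, ih]
      intro x hx
      by_cases hz : x = z
      · subst hz; simp
      · rw [Function.update_of_ne hz]
        exact h x (by simp [fv, hx, hz])
  | box t X φ ih =>
      have h1 : ∀ v ∈ X, Sum.elim s Sum.inr v = v := by
        rintro (x | d) hv
        · exact h x hv
        · rfl
      have h2 : restrict s X = Sum.inl := by
        funext y
        by_cases hy : Sum.inl y ∈ X
        · simp [restrict, hy, h y hy]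
        · simp [restrict, hy]
      rw [subst, h2, ih fun _ _ => rfl]
      congr 1
      ext v
      rw [Finset.mem_image]
      exact ⟨fun ⟨u, hu, e⟩ => by rw [← e, h1 u hu]; exact hu, fun hv => ⟨v, hv, h1 v hv⟩⟩

theorem subst_inl (φ : Formula D) : subst Sum.inl φ = φ := subst_eq_self fun _ _ => rfl

theorem subst_single_of_notMem {φ : Formula D} {x : ℕ} (h : Sum.inl x ∉ φ.fv) (v : ℕ ⊕ D) :
    subst (single x v) φ = φ :=
  subst_eq_self fun y hy => single_of_ne (fun e => h (by rw [← e]; exact hy)) v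

theorem freeFor_of_eq {φ : Formula D} {s : ℕ → ℕ ⊕ D}
    (h : ∀ x : ℕ, Sum.inl x ∈ φ.fv → s x = Sum.inl x) : FreeFor s φ := by
  induction φ generalizing s with
  | atom n P args => trivial
  | bot => trivial
  | imp φ ψ h1 h2 =>
      simp only [fv, Finset.mem_union] at h
      exact ⟨h1 fun x hx => h x (Or.inl hx), h2 fun x hx => h x (Or.inr hx)⟩
  | all z φ ih =>
      have h' : ∀ x : ℕ, Sum.inl x ∈ φ.fv → x ≠ z → s x = Sum.inl x := fun x hx hz =>
        h x (by simp [fv, hx, hz])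
      refine ⟨ih fun x hx => ?_, fun x hx hz e => hz ?_⟩
      · by_cases hz : x = z
        · subst hz; simp
        · rw [Function.update_of_ne hz, h' x hx hz]
      · rw [h' x hx hz] at e
        exact Sum.inl.inj e
  | box t X φ ih =>
      refine ⟨ih fun x _ => ?_, fun x hx _ => ?_⟩
      · by_cases hX : Sum.inl x ∈ X
        · simp [restrict, hX, h x hX]
        · simp [restrict, hX]
      · rw [h x hx]
        exact hx

theorem freeFor_inl (φ : Formula D) : FreeFor Sum.inl φ := freeFor_of_eq fun _ _ => rfl

theorem freeFor_single_of_notMem {φ : Formula D} {x : ℕ} (h : Sum.inl x ∉ φ.fv) (v : ℕ ⊕ D) :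
    FreeFor (single x v) φ :=
  freeFor_of_eq fun y hy => single_of_ne (fun e => h (by rw [← e]; exact hy)) v

/-- Substituting `y` for `x` and then `x` for `y` is the identity if `y` does not occur. -/
theorem subst_single_subst_single {φ : Formula D} {x y : ℕ} (hy : Sum.inl y ∉ φ.occ) :
    subst (single y (Sum.inl x)) (subst (single x (Sum.inl y)) φ) = φ := by
  classical
  induction φ with
  | atom n P args =>
      simp only [subst, atom.injEq, heq_eq_eq, true_and]
      funext i
      have hi : args i ≠ Sum.inl y := fun e => hy ⟨i, e⟩
      by_cases hx : args i = Sum.inl x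
      · simp [hx, single_self]
      · rw [elim_single hx, elim_single hi]
  | bot => rfl
  | imp φ ψ h1 h2 =>
      simp only [occ, Set.mem_union, not_or] at hy
      rw [subst, subst, h1 hy.1, h2 hy.2]
  | all z φ ih =>
      simp only [occ, Set.mem_union, Set.mem_singleton_iff, not_or] at hy
      have hzy : z ≠ y := fun e => hy.1 (by rw [e])
      rw [subst, subst, update_single_of_ne hzy]
      by_cases hz : z = x
      · subst hz
        -- The quantifier on `x` shields the body from the inner substitution, so `y` is still
        -- absent when the outer one arrives.
        rw [update_single_self, subst_inl,
          subst_single_of_notMem fun h => hy.2 (mem_occ_of_mem_fv h)]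
      · rw [update_single_of_ne hz, ih hy.2]
  | box t X φ ih =>
      by_cases hx : Sum.inl x ∈ X
      · simp only [occ, Set.mem_union, Finset.mem_coe, not_or] at hy
        rw [subst, subst, restrict_single_of_mem hx, restrict_single_of_mem, ih hy.2,
          Finset.image_image]
        · congr 1
          ext v
          rw [Finset.mem_image]
          have key : ∀ u ∈ X, (Sum.elim (single y (Sum.inl x)) Sum.inr ∘
              Sum.elim (single x (Sum.inl y)) Sum.inr) u = u := by
            intro u hu
            rw [Function.comp_apply]
            by_cases hux : u = Sum.inl x
            · simp [hux, single_self]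
            · rw [elim_single hux, elim_single fun e => hy.1 (by rw [← e]; exact hu)]
          exact ⟨fun ⟨u, hu, e⟩ => by rw [← e, key u hu]; exact hu, fun hv => ⟨v, hv, key v hv⟩⟩
        · rw [Finset.mem_image]
          exact ⟨_, hx, single_self x _⟩
      · rw [subst_single_of_notMem (φ := box t X φ) hx, subst_single_of_notMem]
        exact fun h => hy (mem_occ_of_mem_fv h)

theorem inl_notMem_fv_subst_single {φ : Formula D} {x y : ℕ} (hxy : x ≠ y) :
    Sum.inl x ∉ (subst (single x (Sum.inl y)) φ).fv := by
  have key : ∀ u : ℕ ⊕ D, Sum.elim (single x (Sum.inl y)) Sum.inr u ≠ Sum.inl x := by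
    intro u
    by_cases hu : u = Sum.inl x
    · subst hu
      simp only [Sum.elim_inl, single_self]
      exact fun e => hxy (Sum.inl.inj e).symm
    · rwa [elim_single hu]
  induction φ with
  | atom n P args =>
      simp only [subst, fv, Finset.mem_image, not_exists, not_and]
      exact fun i _ => key (args i)
  | bot => simp [subst, fv]
  | imp φ ψ h1 h2 => simp [subst, fv, h1, h2]
  | all z φ ih =>
      by_cases hz : z = x
      · simp [subst, fv, hz]
      · simp [subst, fv, update_single_of_ne hz, ih]
  | box t X φ ih =>
      simp only [subst, fv, Finset.mem_image, not_exists, not_and]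
      exact fun u _ => key u

/-- After the replacement `y` is free only where `x` was, hence never under a quantifier on `x`; and
`x` is no longer free in the body of a box that could capture it. -/
theorem freeFor_single_subst_single {φ : Formula D} {x y : ℕ} (hy : Sum.inl y ∉ φ.occ)
    (hxy : x ≠ y) : FreeFor (single y (Sum.inl x)) (subst (single x (Sum.inl y)) φ) := by
  classical
  induction φ with
  | atom n P args => trivial
  | bot => trivial
  | imp φ ψ h1 h2 =>
      simp only [occ, Set.mem_union, not_or] at hy
      exact ⟨h1 hy.1, h2 hy.2⟩
  | all z φ ih =>
      simp only [occ, Set.mem_union, Set.mem_singleton_iff, not_or] at hy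
      have hzy : z ≠ y := fun e => hy.1 (by rw [e])
      rw [subst, FreeFor, update_single_of_ne hzy]
      by_cases hz : z = x
      · subst hz
        have h : Sum.inl y ∉ φ.fv := fun h => hy.2 (mem_occ_of_mem_fv h)
        rw [update_single_self, subst_inl]
        refine ⟨?_, fun w hw hwz => ?_⟩
        · exact freeFor_single_of_notMem h _
        · rw [single_of_ne fun e => h (by rw [← e]; exact hw)]
          exact fun e => hwz (Sum.inl.inj e)
      · rw [update_single_of_ne hz]
        refine ⟨ih hy.2, fun w hw hwz => ?_⟩
        by_cases hwy : w = y
        · rw [hwy, single_self]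
          exact fun e => hz (Sum.inl.inj e).symm
        · rw [single_of_ne hwy]
          exact fun e => hwz (Sum.inl.inj e)
  | box t X φ ih =>
      by_cases hx : Sum.inl x ∈ X
      · simp only [occ, Set.mem_union, Finset.mem_coe, not_or] at hy
        rw [subst, FreeFor, restrict_single_of_mem hx, restrict_single_of_mem]
        · refine ⟨ih hy.2, fun w hw h => ?_⟩
          by_cases hwy : w = y
          · rw [hwy, single_self] at h
            exact absurd h (inl_notMem_fv_subst_single hxy)
          · rw [single_of_ne hwy]
            exact hw
        · rw [Finset.mem_image]
          exact ⟨_, hx, single_self x _⟩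
      · rw [subst_single_of_notMem (φ := box t X φ) hx]
        exact freeFor_single_of_notMem (fun h => hy (mem_occ_of_mem_fv h)) _

/-! ### Substitution of domain elements -/

/-- Quantifiers cannot capture a domain element, and `WF` is exactly the condition that rules out
capture by a box. -/
theorem freeFor_single_inr {φ : Formula D} (hφ : φ.WF) (x : ℕ) (a : D) :
    FreeFor (single x (Sum.inr a)) φ := by
  induction φ with
  | atom n P args => trivial
  | bot => trivial
  | imp φ ψ h1 h2 => exact ⟨h1 hφ.1, h2 hφ.2⟩
  | all z φ ih =>
      rw [FreeFor]
      by_cases hz : z = x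
      · subst hz
        rw [update_single_self]
        exact ⟨freeFor_inl φ, fun w _ hw => by simp [single_of_ne hw, hw]⟩
      · rw [update_single_of_ne hz]
        refine ⟨ih hφ, fun w _ hwz => ?_⟩
        by_cases hw : w = x
        · simp [hw, single_self]
        · simp [single_of_ne hw, hwz]
  | box t X φ ih =>
      by_cases hx : Sum.inl x ∈ X
      · rw [FreeFor, restrict_single_of_mem hx]
        refine ⟨ih hφ.1, fun w hw h => ?_⟩
        by_cases hwx : w = x
        · rw [hwx, single_self] at h ⊢
          exact hφ.2 (inr_mem_consts.2 h)
        · rwa [single_of_ne hwx]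
      · exact freeFor_single_of_notMem (φ := box t X φ) hx _

theorem mem_fv_subst_single_inr {φ : Formula D} {x : ℕ} {a : D} {v : ℕ ⊕ D} :
    v ∈ (subst (single x (Sum.inr a)) φ).fv ↔
      (v ∈ φ.fv ∧ v ≠ Sum.inl x) ∨ (Sum.inl x ∈ φ.fv ∧ v = Sum.inr a) := by
  have key : ∀ u : ℕ ⊕ D, Sum.elim (single x (Sum.inr a)) Sum.inr u = v ↔
      (u = v ∧ v ≠ Sum.inl x) ∨ (u = Sum.inl x ∧ v = Sum.inr a) := by
    intro u
    by_cases hu : u = Sum.inl x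
    · subst hu
      simp only [Sum.elim_inl, single_self]
      grind
    · rw [elim_single hu]
      grind
  induction φ with
  | atom n P args =>
      simp only [subst, fv, Finset.mem_image, Finset.mem_univ, true_and, key]
      grind
  | bot => simp [subst, fv]
  | imp φ ψ h1 h2 =>
      simp only [subst, fv, Finset.mem_union, h1, h2]
      grind
  | all z φ ih =>
      by_cases hz : z = x
      · subst hz
        simp only [subst, update_single_self, subst_inl, fv, Finset.mem_erase]
        grind
      · simp only [subst, update_single_of_ne hz, fv, Finset.mem_erase, ih]
        grind
  | box t X φ ih =>
      simp only [subst, fv, Finset.mem_image, key]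
      grind

theorem IsClosed.subst_single_inr {φ : Formula D} {x : ℕ} (h : (all x φ).IsClosed) (a : D) :
    (subst (single x (Sum.inr a)) φ).IsClosed := by
  intro y hy
  rw [mem_fv_subst_single_inr] at hy
  rcases hy with ⟨hy, hyx⟩ | ⟨-, hy⟩
  · exact h y (by simpa [fv, hy] using hyx)
  · simp at hy

theorem WF.subst_single_inr {φ : Formula D} (hφ : φ.WF) (x : ℕ) (a : D) :
    (subst (single x (Sum.inr a)) φ).WF := by
  classical
  induction φ with
  | atom n P args => trivial
  | bot => trivial
  | imp φ ψ h1 h2 => exact ⟨h1 hφ.1, h2 hφ.2⟩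
  | all z φ ih =>
      by_cases hz : z = x
      · subst hz
        rw [subst, update_single_self, subst_inl]
        exact hφ
      · rw [subst, update_single_of_ne hz]
        exact ih hφ
  | box t X φ ih =>
      by_cases hx : Sum.inl x ∈ X
      · rw [subst, restrict_single_of_mem hx]
        refine ⟨ih hφ.1, fun v hv => ?_⟩
        rw [mem_consts, mem_fv_subst_single_inr] at hv
        rw [Finset.mem_image]
        rcases hv with ⟨⟨h, h'⟩ | ⟨-, rfl⟩, hr⟩
        · exact ⟨v, hφ.2 (mem_consts.2 ⟨h, hr⟩), elim_single h' _⟩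
        · exact ⟨_, hx, single_self x _⟩
      · rw [subst_single_of_notMem (φ := box t X φ) hx]
        exact hφ

/-- A domain element is inert under later substitutions, so the two merge without any capture
condition. -/
theorem subst_subst_single_inr (φ : Formula D) (s : ℕ → ℕ ⊕ D) (x : ℕ) (a : D) :
    subst s (subst (single x (Sum.inr a)) φ) = subst (Function.update s x (Sum.inr a)) φ := by
  classical
  have key : ∀ (s : ℕ → ℕ ⊕ D) (u : ℕ ⊕ D), Sum.elim s Sum.inr (Sum.elim (single x (Sum.inr a)) Sum.inr u) =
      Sum.elim (Function.update s x (Sum.inr a)) Sum.inr u := by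
    rintro s (y | d)
    · by_cases hy : y = x
      · simp [hy, single_self]
      · simp [hy, single_of_ne hy]
    · rfl
  induction φ generalizing s with
  | atom n P args => simp only [subst, key]
  | bot => rfl
  | imp φ ψ h1 h2 => rw [subst, subst, h1, h2, subst]
  | all z φ ih =>
      by_cases hz : z = x
      · subst hz
        rw [subst, subst, update_single_self, subst_inl, subst, Function.update_idem]
      · rw [subst, subst, update_single_of_ne hz, ih, subst, Function.update_comm hz]
  | box t X φ ih =>
      by_cases hx : Sum.inl x ∈ X
      · rw [subst, subst, restrict_single_of_mem hx, ih, subst, Finset.image_image]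
        congr 2
        · funext u
          exact key s u
        · funext y
          by_cases hy : y = x
          · simp [hy, restrict, hx]
          · have h : Sum.inl y ∈ X.image (Sum.elim (single x (Sum.inr a)) Sum.inr) ↔
                Sum.inl y ∈ X := by
              rw [Finset.mem_image]
              refine ⟨fun ⟨u, hu, e⟩ => ?_, fun h => ⟨_, h, single_of_ne hy _⟩⟩
              by_cases hux : u = Sum.inl x
              · simp [hux, single_self] at e
              · rw [elim_single hux] at e
                rwa [← e]
            rw [Function.update_of_ne hy]
            simp only [restrict, h, Function.update_of_ne hy]
      · rw [subst_single_of_notMem (φ := box t X φ) hx, subst, subst]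
        congr 1
        · refine Finset.image_congr fun u hu => ?_
          rcases u with y | d
          · have hy : y ≠ x := fun e => hx (by rw [← e]; exact hu)
            simp [hy]
          · rfl
        · congr 1
          funext y
          by_cases hy : y = x
          · simp [hy, restrict, hx]
          · simp [restrict, hy]

/-! ### Domain formulas of the basic language -/

theorem isLeft_of_mem_fv_mapD {φ : Fml} {f : Empty → D} {v : ℕ ⊕ D}
    (hv : v ∈ (mapD f φ).fv) : ∃ x, v = Sum.inl x ∧ Sum.inl x ∈ φ.fv := by
  have key : ∀ u : ℕ ⊕ Empty, Sum.map id f u = v → ∃ x, v = Sum.inl x ∧ u = Sum.inl x := by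
    rintro (x | e) rfl
    · exact ⟨x, rfl, rfl⟩
    · exact e.elim
  induction φ with
  | atom n P args =>
      simp only [mapD, fv, Finset.mem_image, Finset.mem_univ, true_and] at hv ⊢
      obtain ⟨i, hi⟩ := hv
      obtain ⟨x, h1, h2⟩ := key _ hi
      exact ⟨x, h1, i, h2⟩
  | bot => simp [mapD, fv] at hv
  | imp φ ψ h1 h2 =>
      simp only [mapD, fv, Finset.mem_union] at hv ⊢
      rcases hv with hv | hv
      · obtain ⟨x, h, h'⟩ := h1 hv
        exact ⟨x, h, Or.inl h'⟩
      · obtain ⟨x, h, h'⟩ := h2 hv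
        exact ⟨x, h, Or.inr h'⟩
  | all z φ ih =>
      simp only [mapD, fv, Finset.mem_erase] at hv ⊢
      obtain ⟨x, rfl, h'⟩ := ih hv.2
      exact ⟨x, rfl, fun e => hv.1 (by rw [Sum.inl.inj e]), h'⟩
  | box t X φ ih =>
      simp only [mapD, fv, Finset.mem_image] at hv ⊢
      obtain ⟨u, hu, e⟩ := hv
      obtain ⟨x, h1, h2⟩ := key _ e
      exact ⟨x, h1, h2 ▸ hu⟩

theorem IsClosed.mapD {φ : Fml} (hφ : φ.IsClosed) (f : Empty → D) : (mapD f φ).IsClosed := by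
  intro x hx
  obtain ⟨y, -, h⟩ := isLeft_of_mem_fv_mapD hx
  exact hφ y h

theorem consts_mapD (φ : Fml) (f : Empty → D) : (mapD f φ).consts = ∅ := by
  refine Finset.eq_empty_of_forall_notMem fun v hv => ?_
  rw [mem_consts] at hv
  obtain ⟨x, rfl, -⟩ := isLeft_of_mem_fv_mapD hv.1
  simp at hv

theorem wf_mapD (φ : Fml) (f : Empty → D) : (mapD f φ).WF := by
  induction φ with
  | atom n P args => trivial
  | bot => trivial
  | imp φ ψ h1 h2 => exact ⟨h1, h2⟩
  | all z φ ih => exact ih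
  | box t X φ ih => exact ⟨ih, by simp [consts_mapD]⟩

/-! ### Domain elements as fresh variables -/

/-- The domain element `d` is read as the variable `d + n`. -/
def asVar (n : ℕ) : ℕ ⊕ ℕ → ℕ ⊕ Empty := Sum.elim Sum.inl fun d => Sum.inl (d + n)

/-- Domain elements `d` are replaced by variables `d + n`. -/
noncomputable def enc (n : ℕ) : Formula ℕ → Fml
  | atom k P args => atom k P (fun i => asVar n (args i))
  | bot => bot
  | imp φ ψ => imp (enc n φ) (enc n ψ)
  | all x φ => all x (enc n φ)
  | box t X φ => open scoped Classical in box t (X.image (asVar n)) (enc n φ)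

/-- Only variables less than `n` occur. -/
def Below (n : ℕ) (φ : Formula ℕ) : Prop := ∀ x : ℕ, Sum.inl x ∈ φ.occ → x < n

open Filter in
theorem eventually_below (φ : Formula ℕ) : ∀ᶠ n in atTop, φ.Below n := by
  have h : {x : ℕ | Sum.inl x ∈ φ.occ}.Finite := φ.finite_occ.preimage Sum.inl_injective.injOn
  obtain ⟨N, hN⟩ := h.bddAbove
  filter_upwards [eventually_gt_atTop N] with n hn x hx
  exact (hN hx).trans_lt hn

theorem Below.of_occ_subset {n : ℕ} {φ ψ : Formula ℕ} (h : φ.Below n) (hs : ψ.occ ⊆ φ.occ) :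
    ψ.Below n := fun x hx => h x (hs hx)

theorem Below.left {n : ℕ} {φ ψ : Formula ℕ} (h : (imp φ ψ).Below n) : φ.Below n :=
  h.of_occ_subset Set.subset_union_left

theorem Below.right {n : ℕ} {φ ψ : Formula ℕ} (h : (imp φ ψ).Below n) : ψ.Below n :=
  h.of_occ_subset Set.subset_union_right

theorem Below.of_all {n x : ℕ} {φ : Formula ℕ} (h : (all x φ).Below n) : φ.Below n :=
  h.of_occ_subset Set.subset_union_right

theorem Below.of_box {n : ℕ} {t : JTerm} {X : Finset (ℕ ⊕ ℕ)} {φ : Formula ℕ}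
    (h : (box t X φ).Below n) : φ.Below n :=
  h.of_occ_subset Set.subset_union_right

/-- The bound is needed because the code d + n of a domain element collides with the variables from
n on. -/
theorem asVar_inj {n : ℕ} {u v : ℕ ⊕ ℕ} (hu : ∀ x, u = Sum.inl x → x < n)
    (hv : ∀ x, v = Sum.inl x → x < n) (h : asVar n u = asVar n v) : u = v := by
  rcases u with x | d <;> rcases v with y | e <;> simp [asVar] at h hu hv ⊢ <;> omega

theorem asVar_eq_inl {n y : ℕ} {u : ℕ ⊕ ℕ} (h : asVar n u = Sum.inl y) :
    u = Sum.inl y ∨ ∃ d, u = Sum.inr d ∧ y = d + n := by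
  rcases u with x | d
  · left
    simpa [asVar] using h
  · right
    exact ⟨d, rfl, by simpa [asVar] using h.symm⟩

/-- Quantified variables lie below `n`, so no quantifier binds the code d + n of a domain element.
-/
theorem mem_fv_enc {n : ℕ} {φ : Formula ℕ} (h : φ.Below n) {v : ℕ ⊕ Empty} :
    v ∈ (enc n φ).fv ↔ ∃ u ∈ φ.fv, asVar n u = v := by
  induction φ with
  | atom k P args => simp [enc, fv]
  | bot => simp [enc, fv]
  | imp φ ψ h1 h2 =>
      simp only [enc, fv, Finset.mem_union, h1 h.left, h2 h.right]
      grind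
  | all x φ ih =>
      have hx : x < n := h x (Or.inl rfl)
      simp only [enc, fv, Finset.mem_erase, ih h.of_all]
      constructor
      · rintro ⟨hv, u, hu, rfl⟩
        exact ⟨u, ⟨fun e => hv (by rw [e]; rfl), hu⟩, rfl⟩
      · rintro ⟨u, ⟨hux, hu⟩, rfl⟩
        refine ⟨fun e => ?_, u, hu, rfl⟩
        rcases asVar_eq_inl e with e | ⟨d, -, e⟩
        · exact hux e
        · omega
  | box t X φ ih => simp [enc, fv]

theorem mem_occ_enc {n : ℕ} {φ : Formula ℕ} {v : ℕ ⊕ Empty} (hv : v ∈ (enc n φ).occ) :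
    ∃ u ∈ φ.occ, asVar n u = v := by
  induction φ with
  | atom k P args => simpa [enc, occ] using hv
  | bot => simp [enc, occ] at hv
  | imp φ ψ h1 h2 =>
      rcases hv with hv | hv
      · obtain ⟨u, hu, e⟩ := h1 hv
        exact ⟨u, Or.inl hu, e⟩
      · obtain ⟨u, hu, e⟩ := h2 hv
        exact ⟨u, Or.inr hu, e⟩
  | all x φ ih =>
      rcases hv with rfl | hv
      · exact ⟨Sum.inl x, Or.inl rfl, rfl⟩
      · obtain ⟨u, hu, e⟩ := ih hv
        exact ⟨u, Or.inr hu, e⟩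
  | box t X φ ih =>
      rcases hv with hv | hv
      · simp only [Finset.mem_coe, Finset.mem_image] at hv
        obtain ⟨u, hu, e⟩ := hv
        exact ⟨u, Or.inl hu, e⟩
      · obtain ⟨u, hu, e⟩ := ih hv
        exact ⟨u, Or.inr hu, e⟩

theorem mem_fv_enc_asVar {n : ℕ} {φ : Formula ℕ} (h : φ.Below n) {u : ℕ ⊕ ℕ}
    (hu : ∀ x, u = Sum.inl x → x < n) : asVar n u ∈ (enc n φ).fv ↔ u ∈ φ.fv := by
  rw [mem_fv_enc h]
  refine ⟨fun ⟨w, hw, e⟩ => ?_, fun hu => ⟨u, hu, rfl⟩⟩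
  rwa [← asVar_inj (fun x hx => h x (hx ▸ mem_occ_of_mem_fv hw)) hu e]

theorem enc_mapD (n : ℕ) (φ : Fml) : enc n (mapD Empty.elim φ) = φ := by
  have key : ∀ u : ℕ ⊕ Empty, asVar n (Sum.map id Empty.elim u) = u := by
    rintro (x | e)
    · rfl
    · exact e.elim
  induction φ with
  | atom k P args => simp [mapD, enc, key]
  | bot => rfl
  | imp φ ψ h1 h2 => rw [mapD, enc, h1, h2]
  | all x φ ih => rw [mapD, enc, ih]
  | box t X φ ih =>
      rw [mapD, enc, ih]
      congr 1
      ext v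
      simp only [Finset.mem_image, exists_exists_and_eq_and, key, exists_eq_right]

/-- Variables from `n` on are codes of domain elements after encoding; substitution leaves domain
elements alone, so `s` has to fix these variables. -/
theorem enc_subst {n : ℕ} {s : ℕ → ℕ ⊕ ℕ} (hs : ∀ y, n ≤ y → s y = Sum.inl y)
    {φ : Formula ℕ} (h : φ.Below n) :
    enc n (subst s φ) = subst (asVar n ∘ s) (enc n φ) := by
  classical
  have key : ∀ (s : ℕ → ℕ ⊕ ℕ), (∀ y, n ≤ y → s y = Sum.inl y) → ∀ u : ℕ ⊕ ℕ,
      asVar n (Sum.elim s Sum.inr u) = Sum.elim (asVar n ∘ s) Sum.inr (asVar n u) := by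
    rintro s hs (x | d)
    · rfl
    · simp [asVar, hs (d + n) (by omega)]
  induction φ generalizing s with
  | atom k P args => simp [subst, enc, key s hs]
  | bot => rfl
  | imp φ ψ h1 h2 => rw [subst, enc, h1 hs h.left, h2 hs h.right, enc, subst]
  | all x φ ih =>
      have hx : x < n := h x (Or.inl rfl)
      rw [subst, enc, ih _ h.of_all, enc, subst, Function.comp_update]
      · rfl
      · intro y hy
        rw [Function.update_of_ne (by omega), hs y hy]
  | box t X φ ih =>
      rw [subst, enc, ih _ h.of_box, enc, subst]
      · congr 1
        · ext v
          simp only [Finset.mem_image, exists_exists_and_eq_and, key s hs]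
        · congr 1
          funext y
          rcases lt_or_ge y n with hy | hy
          · have : Sum.inl y ∈ X.image (asVar n) ↔ Sum.inl y ∈ X := by
              rw [Finset.mem_image]
              refine ⟨fun ⟨u, hu, e⟩ => ?_, fun h => ⟨_, h, rfl⟩⟩
              rcases asVar_eq_inl e with rfl | ⟨d, -, e⟩
              · exact hu
              · omega
            simp only [restrict, Function.comp_apply, this]
            split_ifs <;> rfl
          · simp [restrict, hs y hy, asVar]
      · intro y hy
        simp [restrict, hs y hy]

/-- The hypothesis `hs'` keeps variables introduced by `s` apart from the codes d + n; otherwise one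
could coincide with a domain element of the body of a box and be captured there. -/
theorem FreeFor.enc {n : ℕ} {s : ℕ → ℕ ⊕ ℕ} (hs : ∀ y, n ≤ y → s y = Sum.inl y)
    (hs' : ∀ x y, x < n → s x = Sum.inl y → y < n)
    {φ : Formula ℕ} (h : φ.Below n) (hf : FreeFor s φ) :
    FreeFor (asVar n ∘ s) (enc n φ) := by
  classical
  induction φ generalizing s with
  | atom k P args => trivial
  | bot => trivial
  | imp φ ψ h1 h2 => exact ⟨h1 hs hs' h.left hf.1, h2 hs hs' h.right hf.2⟩
  | all z φ ih =>
      have hz : z < n := h z (Or.inl rfl)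
      refine ⟨?_, fun x hx hxz e => ?_⟩
      · have := ih (s := Function.update s z (Sum.inl z)) ?_ ?_ h.of_all hf.1
        · rw [Function.comp_update] at this
          exact this
        · intro y hy
          rw [Function.update_of_ne (by omega), hs y hy]
        · intro x y hx e
          by_cases hxz : x = z
          · subst hxz
            simp at e
            omega
          · rw [Function.update_of_ne hxz] at e
            exact hs' x y hx e
      · rcases lt_or_ge x n with hxn | hxn
        · have hx' := (mem_fv_enc_asVar (u := Sum.inl x) h.of_all (by grind)).1 hx
          rcases asVar_eq_inl e with e | ⟨d, -, e⟩
          · exact hf.2 x hx' hxz e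
          · omega
        · rw [Function.comp_apply, hs x hxn] at e
          exact hxz (Sum.inl.inj e)
  | box t X φ ih =>
      refine ⟨?_, fun x hx he => ?_⟩
      · have := ih (s := restrict s X) ?_ ?_ h.of_box hf.1
        · convert this using 1
          funext y
          rcases lt_or_ge y n with hy | hy
          · have : Sum.inl y ∈ X.image (asVar n) ↔ Sum.inl y ∈ X := by
              rw [Finset.mem_image]
              refine ⟨fun ⟨u, hu, e⟩ => ?_, fun h => ⟨_, h, rfl⟩⟩
              rcases asVar_eq_inl e with rfl | ⟨d, -, e⟩
              · exact hu
              · omega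
            simp only [restrict, Function.comp_apply, this]
            split_ifs <;> rfl
          · simp [restrict, hs y hy, asVar]
        · intro y hy
          simp [restrict, hs y hy]
        · intro x y hx e
          simp only [restrict] at e
          split_ifs at e
          · exact hs' x y hx e
          · have := Sum.inl.inj e
            omega
      · rcases lt_or_ge x n with hxn | hxn
        · have h1 : Sum.inl x ∈ X := by
            rw [Finset.mem_image] at hx
            obtain ⟨u, hu, e⟩ := hx
            rcases asVar_eq_inl e with rfl | ⟨d, -, e⟩
            · exact hu
            · omega
          have h2 := (mem_fv_enc_asVar h.of_box (hs' x · hxn)).1 he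
          exact Finset.mem_image_of_mem _ (hf.2 x h1 h2)
        · rw [Function.comp_apply, hs x hxn]
          exact hx

/-- Encoding commutes with → and ⊥, so valuations pull back along it. -/
theorem IsTautology.enc {φ : Formula ℕ} (h : IsTautology φ) (n : ℕ) :
    IsTautology (enc n φ) :=
  fun v h1 h2 => h (fun α => v (Formula.enc n α)) h1 fun _ _ => h2 _ _

theorem asVar_comp_single (n x : ℕ) (v : ℕ ⊕ ℕ) :
    asVar n ∘ single x v = single x (asVar n v) := by
  rw [single, Function.comp_update]
  rfl

end Formula

/-! ### Axioms under the encoding -/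

open Formula Filter

/-- For `n` beyond the variables in the axiom, the encoding is injective on what occurs there, so
side conditions survive. For small `n` a code may clash with a variable, hence "eventually". -/
theorem Ax.enc {φ : Formula ℕ} (h : Ax φ) : ∀ᶠ n in atTop, Ax (Formula.enc n φ) := by
  classical
  induction h with
  | taut h => exact Eventually.of_forall fun n => Ax.taut (h.enc n)
  | allElim x v φ hf =>
      -- The substituted variable need not occur in `φ`, so it is bounded separately.
      have hv : ∀ᶠ n in atTop, ∀ y : ℕ, v = Sum.inl y → y < n := by
        rcases v with y | d
        · filter_upwards [eventually_gt_atTop y] with n hn z hz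
          rwa [← Sum.inl.inj hz]
        · exact Eventually.of_forall fun n y hy => nomatch hy
      filter_upwards [eventually_below φ, hv, eventually_gt_atTop x] with n hn hv hx
      have h1 : ∀ y, n ≤ y → single x v y = Sum.inl y := fun y hy => single_of_ne (by omega) v
      rw [Formula.enc, Formula.enc, enc_subst h1 hn, asVar_comp_single]
      refine Ax.allElim x _ _ ?_
      rw [← asVar_comp_single]
      refine hf.enc h1 (fun y z hy e => ?_) hn
      by_cases hyx : y = x
      · rw [hyx, single_self] at e
        exact hv z e
      · rw [single_of_ne hyx] at e
        rwa [← Sum.inl.inj e]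
  | allImp x φ ψ hx =>
      filter_upwards [eventually_below φ, eventually_gt_atTop x] with n hn hxn
      refine Ax.allImp x _ _ fun h => hx ?_
      exact (mem_fv_enc_asVar (u := Sum.inl x) hn (by grind)).1 h
  | a2 t X y φ hX hy =>
      have h := eventually_below (box t (insert y X) φ)
      filter_upwards [h] with n hn
      have hy' : ∀ x, y = Sum.inl x → x < n := fun x hx => hn x (Or.inl (by simp [hx]))
      have key : asVar n y ∉ X.image (asVar n) := by
        rw [Finset.mem_image]
        rintro ⟨u, hu, e⟩
        rw [asVar_inj (fun x hx => hn x (Or.inl (by simp [← hx, hu]))) hy' e] at hu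
        exact hX hu
      have := Ax.a2 t (X.image (asVar n)) (asVar n y) (Formula.enc n φ) key
        (fun h => hy ((mem_fv_enc_asVar hn.of_box hy').1 h))
      convert this using 1
      simp only [Formula.enc, imp.injEq, box.injEq, true_and, and_true]
      ext v
      simp
  | a3 t X y φ hX =>
      have h := eventually_below (box t (insert y X) φ)
      filter_upwards [h] with n hn
      have hy' : ∀ x, y = Sum.inl x → x < n := fun x hx => hn x (Or.inl (by simp [hx]))
      have key : asVar n y ∉ X.image (asVar n) := by
        rw [Finset.mem_image]
        rintro ⟨u, hu, e⟩
        rw [asVar_inj (fun x hx => hn x (Or.inl (by simp [← hx, hu]))) hy' e] at hu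
        exact hX hu
      have := Ax.a3 t (X.image (asVar n)) (asVar n y) (Formula.enc n φ) key
      convert this using 1
      simp only [Formula.enc, imp.injEq, box.injEq, true_and, and_true]
      ext v
      simp
  | b1 t X φ => exact Eventually.of_forall fun n => Ax.b1 ..
  | b2 t s X φ ψ => exact Eventually.of_forall fun n => Ax.b2 ..
  | b3l t s X φ => exact Eventually.of_forall fun n => Ax.b3l ..
  | b3r t s X φ => exact Eventually.of_forall fun n => Ax.b3r ..
  | b4 t X φ => exact Eventually.of_forall fun n => Ax.b4 ..
  | b5 t X x φ hx =>
      filter_upwards [eventually_gt_atTop x] with n hn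
      refine Ax.b5 t _ x _ fun h => hx ?_
      rw [Finset.mem_image] at h
      obtain ⟨u, hu, e⟩ := h
      rcases asVar_eq_inl e with rfl | ⟨d, -, e⟩
      · exact hu
      · omega
  | b6 t X φ => exact Eventually.of_forall fun n => Ax.b6 ..

/-- Describing `Y` by its members makes the axiom usable whatever equality test underlies `insert`.
-/
theorem Ax.a2_of_mem_iff {D : Type} {t : JTerm} {X Y : Finset (ℕ ⊕ D)} {y : ℕ ⊕ D}
    {φ : Formula D} (hX : y ∉ X) (hy : y ∉ φ.fv) (hY : ∀ v, v ∈ Y ↔ v = y ∨ v ∈ X) :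
    Ax (imp (box t Y φ) (box t X φ)) := by
  classical
  obtain rfl : Y = insert y X := by ext v; rw [hY, Finset.mem_insert]
  convert Ax.a2 t X y φ hX hy

theorem Ax.a3_of_mem_iff {D : Type} {t : JTerm} {X Y : Finset (ℕ ⊕ D)} {y : ℕ ⊕ D}
    {φ : Formula D} (hX : y ∉ X) (hY : ∀ v, v ∈ Y ↔ v = y ∨ v ∈ X) :
    Ax (imp (box t X φ) (box t Y φ)) := by
  classical
  obtain rfl : Y = insert y X := by ext v; rw [hY, Finset.mem_insert]
  convert Ax.a3 t X y φ hX

/-! ### Derivations in the basic language -/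

namespace Provable

variable {CS : Set Fml} {α β γ : Fml}

theorem trans (h1 : Provable CS (imp α β)) (h2 : Provable CS (imp β γ)) :
    Provable CS (imp α γ) := by
  refine mp h2 (mp h1 (ax (Ax.taut fun v _ hi => ?_)))
  simp only [hi]
  tauto

theorem all_imp {x : ℕ} (hx : Sum.inl x ∉ α.fv) (h : Provable CS (imp α β)) :
    Provable CS (imp α (all x β)) :=
  mp (gen x h) (ax (Ax.allImp x α β hx))

/-- Generalization on a fresh variable `y` in place of `x`. -/
theorem all_of_fresh {x y : ℕ} (hα : Sum.inl y ∉ α.fv) (hβ : Sum.inl y ∉ β.occ) (hxy : x ≠ y)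
    (h : Provable CS (imp α (subst (single x (Sum.inl y)) β))) :
    Provable CS (imp α (all x β)) := by
  -- Generalizing on `y` gives ∀y β(y); instantiating it back to `x` and generalizing on `x` renames
  -- the bound variable.
  have h1 := ax (CS := CS) (Ax.allElim y _ _ (freeFor_single_subst_single hβ hxy))
  rw [subst_single_subst_single hβ] at h1
  refine (all_imp hα h).trans (all_imp ?_ h1)
  simp [fv, inl_notMem_fv_subst_single hxy]

end Provable

/-! ### Provability of formulas with domain elements -/

/-- Provability with the domain elements read as fresh variables. -/
def DProv (CS : Set Fml) (φ : Formula ℕ) : Prop := ∀ᶠ n in atTop, Provable CS (enc n φ)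

namespace DProv

variable {CS : Set Fml} {α β γ : Formula ℕ}

theorem ax (h : Ax α) : DProv CS α := h.enc.mono fun _ => Provable.ax

theorem mp (h1 : DProv CS (imp α β)) (h2 : DProv CS α) : DProv CS β := by
  filter_upwards [h1, h2] with n h1 h2 using Provable.mp h2 h1

theorem gen (x : ℕ) (h : DProv CS α) : DProv CS (all x α) := h.mono fun _ => Provable.gen x

theorem trans (h1 : DProv CS (imp α β)) (h2 : DProv CS (imp β γ)) : DProv CS (imp α γ) := by
  filter_upwards [h1, h2] with n h1 h2 using h1.trans h2

theorem all_imp {x : ℕ} (hx : Sum.inl x ∉ α.fv) (h : DProv CS (imp α β)) :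
    DProv CS (imp α (all x β)) :=
  mp (ax (Ax.allImp x α β hx)) (gen x h)

/-- With no domain elements the encoding does not depend on n, so the extended provability is
conservative. -/
theorem mapD {φ : Fml} : DProv CS (mapD Empty.elim φ) ↔ Provable CS φ := by
  simp only [DProv, enc_mapD, eventually_const]

/-- Generalization on a fresh domain element. -/
theorem all_of_fresh {x d : ℕ} (hα : Sum.inr d ∉ α.occ) (hβ : Sum.inr d ∉ β.occ)
    (h : DProv CS (imp α (subst (single x (Sum.inr d)) β))) : DProv CS (imp α (all x β)) := by
  filter_upwards [h, eventually_below α, eventually_below β, eventually_gt_atTop x]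
    with n h hnα hnβ hx
  have h1 : ∀ y, n ≤ y → single x (Sum.inr d : ℕ ⊕ ℕ) y = Sum.inl y :=
    fun y hy => single_of_ne (by omega) _
  have hfresh : ∀ φ : Formula ℕ, φ.Below n → Sum.inr d ∉ φ.occ →
      -- Injectivity of the encoding on symbols occurring in `φ` turns the fresh element `d` into a
      -- fresh variable.
      Sum.inl (d + n) ∉ (enc n φ).occ := by
    intro φ hφ hd hocc
    obtain ⟨u, hu, e⟩ := mem_occ_enc hocc
    rw [asVar_inj (v := Sum.inr d) (fun x hx => hφ x (hx ▸ hu)) (fun x hx => nomatch hx) e] at hu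
    exact hd hu
  rw [enc, enc_subst h1 hnβ, asVar_comp_single] at h
  exact Provable.all_of_fresh (fun h => hfresh α hnα hα (mem_occ_of_mem_fv h))
    (hfresh β hnβ hβ) (by omega) h

end DProv

/-! ### Henkin sets -/

/-- Maximal consistent sets in which every false generalization has a counterexample. -/
structure IsHenkin (CS : Set Fml) (Γ : Set (Formula ℕ)) : Prop where
  prov : ∀ {α}, DProv CS α → α ∈ Γ
  mp : ∀ {α β}, imp α β ∈ Γ → α ∈ Γ → β ∈ Γ
  bot : bot ∉ Γ
  neg : ∀ {α}, α ∉ Γ → neg α ∈ Γ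
  witness : ∀ {x α}, all x α ∉ Γ → ∃ d, subst (single x (Sum.inr d)) α ∉ Γ

/-! ### Countability of the language -/

/-- A numerical code of a term. -/
def JTerm.code : JTerm → ℕ
  | var i => Nat.pair 0 i
  | const i => Nat.pair 1 i
  | app t s => Nat.pair 2 (Nat.pair t.code s.code)
  | sum t s => Nat.pair 3 (Nat.pair t.code s.code)
  | bang t => Nat.pair 4 t.code
  | query t => Nat.pair 5 t.code
  | gen x t => Nat.pair 6 (Nat.pair x t.code)

theorem JTerm.code_injective : Function.Injective JTerm.code := by
  intro t
  induction t with
  | var i => rintro (_ | _ | _ | _ | _ | _ | _) h <;> simp_all [code, Nat.pair_eq_pair]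
  | const i => rintro (_ | _ | _ | _ | _ | _ | _) h <;> simp_all [code, Nat.pair_eq_pair]
  | app t s h1 h2 =>
      rintro (_ | _ | _ | _ | _ | _ | _) h <;> simp [code, Nat.pair_eq_pair] at h
      rw [h1 h.1, h2 h.2]
  | sum t s h1 h2 =>
      rintro (_ | _ | _ | _ | _ | _ | _) h <;> simp [code, Nat.pair_eq_pair] at h
      rw [h1 h.1, h2 h.2]
  | bang t h1 =>
      rintro (_ | _ | _ | _ | _ | _ | _) h <;> simp [code, Nat.pair_eq_pair] at h
      rw [h1 h]
  | query t h1 =>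
      rintro (_ | _ | _ | _ | _ | _ | _) h <;> simp [code, Nat.pair_eq_pair] at h
      rw [h1 h]
  | gen x t h1 =>
      rintro (_ | _ | _ | _ | _ | _ | _) h <;> simp [code, Nat.pair_eq_pair] at h
      rw [h.1, h1 h.2]

/-- A numerical code of a formula. -/
def Formula.code : Formula ℕ → ℕ
  | atom n P args =>
      Nat.pair 0 (Nat.pair P (Encodable.encode (⟨n, args⟩ : Σ n, Fin n → ℕ ⊕ ℕ)))
  | bot => Nat.pair 1 0
  | imp φ ψ => Nat.pair 2 (Nat.pair φ.code ψ.code)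
  | all x φ => Nat.pair 3 (Nat.pair x φ.code)
  | box t X φ => Nat.pair 4 (Nat.pair t.code (Nat.pair (Encodable.encode X) φ.code))

theorem Formula.code_injective : Function.Injective Formula.code := by
  intro φ
  induction φ with
  | atom n P args =>
      rintro (_ | _ | _ | _ | _) h <;> simp [code, Nat.pair_eq_pair] at h
      obtain ⟨rfl, rfl, h⟩ := h
      rw [Encodable.encode_injective h]
  | bot => rintro (_ | _ | _ | _ | _) h <;> simp_all [code, Nat.pair_eq_pair]
  | imp φ ψ h1 h2 =>
      rintro (_ | _ | _ | _ | _) h <;> simp [code, Nat.pair_eq_pair] at h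
      rw [h1 h.1, h2 h.2]
  | all x φ h1 =>
      rintro (_ | _ | _ | _ | _) h <;> simp [code, Nat.pair_eq_pair] at h
      rw [h.1, h1 h.2]
  | box t X φ h1 =>
      rintro (_ | _ | _ | _ | _) h <;> simp [code, Nat.pair_eq_pair] at h
      rw [JTerm.code_injective h.1, h.2.1, h1 h.2.2]

/-! ### The Lindenbaum–Henkin construction -/

/-- `α` may be added to the theory given by `θ`. -/
theorem exists_consistent_step {CS : Set Fml} {θ : Formula ℕ} (hθ : ¬ DProv CS (neg θ))
    (χ : Formula ℕ) : ∃ θ', ¬ DProv CS (neg θ') ∧ DProv CS (imp θ' θ) ∧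
      (DProv CS (imp θ' χ) ∨ DProv CS (imp θ' (neg χ)) ∧
        ∀ x α, χ = all x α → ∃ d, DProv CS (imp θ' (neg (subst (single x (Sum.inr d)) α)))) := by
  by_cases h : DProv CS (imp θ χ)
  · refine ⟨θ, hθ, DProv.ax (Ax.taut fun v _ hi => ?_), Or.inl h⟩
    simp [hi]
  by_cases hall : ∃ x α, χ = all x α
  · obtain ⟨x, α, rfl⟩ := hall
    obtain ⟨d, hd⟩ : ∃ d : ℕ, d ∉ Sum.inr ⁻¹' (θ.occ ∪ α.occ) :=
      ((θ.finite_occ.union α.finite_occ).preimage Sum.inr_injective.injOn).infinite_compl.nonempty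
    simp only [Set.mem_preimage, Set.mem_union, not_or] at hd
    have hd' : Sum.inr d ∉ (neg (imp θ (all x α))).occ := by simp [neg, occ, hd]
    -- This is θ ∧ ¬∀x α ∧ ¬α(d) written with → and ⊥. A refutation proves θ ∧ ¬∀x α → α(d);
    -- generalizing over the fresh `d` gives θ ∧ ¬∀x α → ∀x α, that is, θ → ∀x α, which was
    -- excluded.
    refine ⟨neg (imp (neg (imp θ (all x α))) (subst (single x (Sum.inr d)) α)),
      fun hc => h ?_, ?_, Or.inr ⟨?_, ?_⟩⟩
    · have h1 := DProv.all_of_fresh (x := x) hd' hd.2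
        (DProv.mp (DProv.ax (Ax.taut fun v hb hi => ?_)) hc)
      · refine DProv.mp (DProv.ax (Ax.taut fun v hb hi => ?_)) h1
        simp only [hi, hb, neg]
        tauto
      · simp only [hi, hb, neg]
        tauto
    · refine DProv.ax (Ax.taut fun v hb hi => ?_)
      simp only [hi, hb, neg]
      tauto
    · refine DProv.ax (Ax.taut fun v hb hi => ?_)
      simp only [hi, hb, neg]
      tauto
    · rintro y β e
      obtain ⟨rfl, rfl⟩ := by simpa using e
      refine ⟨d, DProv.ax (Ax.taut fun v hb hi => ?_)⟩
      simp only [hi, hb, neg]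
      tauto
  -- This is θ ∧ ¬χ; no witness is required.
  · refine ⟨neg (imp θ χ), fun hc => h ?_, ?_, Or.inr ⟨?_, fun x α e => (hall ⟨x, α, e⟩).elim⟩⟩
    · refine DProv.mp (DProv.ax (Ax.taut fun v hb hi => ?_)) hc
      simp only [hi, hb, neg]
      tauto
    · refine DProv.ax (Ax.taut fun v hb hi => ?_)
      simp only [hi, hb, neg]
      tauto
    · refine DProv.ax (Ax.taut fun v hb hi => ?_)
      simp only [hi, hb, neg]
      tauto

/-- Each stage of the theory is a single formula implying the earlier ones. It mentions finitely
many domain elements, so fresh ones always remain; Γ collects the consequences of all stages. -/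
theorem exists_isHenkin {CS : Set Fml} {θ : Formula ℕ} (hθ : ¬ DProv CS (neg θ)) :
    ∃ Γ, IsHenkin CS Γ ∧ θ ∈ Γ := by
  choose f hcons himp hdec using
    fun (p : {θ : Formula ℕ // ¬ DProv CS (neg θ)}) χ => exists_consistent_step p.2 χ
  have : Nonempty (Formula ℕ) := ⟨θ⟩
  have hsurj := Function.invFun_surjective Formula.code_injective
  set e : ℕ → Formula ℕ := Function.invFun Formula.code
  let T : ℕ → {θ : Formula ℕ // ¬ DProv CS (neg θ)} :=
    fun k => Nat.rec ⟨θ, hθ⟩ (fun k p => ⟨f p (e k), hcons p (e k)⟩) k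
  have hT : ∀ {j k}, j ≤ k → DProv CS (imp (T k).1 (T j).1) := by
    intro j k hjk
    induction hjk with
    | refl => exact DProv.ax (Ax.taut fun v _ hi => by simp [hi])
    | step _ ih => exact (himp (T _) (e _)).trans ih
  have hmono : ∀ {j k α}, j ≤ k → DProv CS (imp (T j).1 α) → DProv CS (imp (T k).1 α) :=
    fun hjk h => (hT hjk).trans h
  have hboth : ∀ {j k α}, DProv CS (imp (T j).1 α) → ¬ DProv CS (imp (T k).1 (neg α)) := by
    intro j k α h1 h2
    have h1' := hmono (le_max_left j k) h1
    have h2' := hmono (le_max_right j k) h2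
    refine (T (max j k)).2 (DProv.mp (DProv.mp (DProv.ax (Ax.taut fun v hb hi => ?_)) h1') h2')
    simp only [hi, hb, neg]
    tauto
  have hdec' : ∀ α, (∃ k, DProv CS (imp (T k).1 α)) ∨
      (∃ k, DProv CS (imp (T k).1 (neg α)) ∧ ∀ x β, α = all x β →
        ∃ d, DProv CS (imp (T k).1 (neg (subst (single x (Sum.inr d)) β)))) := by
    intro α
    obtain ⟨k, rfl⟩ := hsurj α
    exact (hdec (T k) (e k)).imp (Exists.intro (k + 1)) (Exists.intro (k + 1))
  refine ⟨{α | ∃ k, DProv CS (imp (T k).1 α)}, ⟨?_, ?_, ?_, ?_, ?_⟩, 0, hT (j := 0) le_rfl⟩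
  · refine fun {α} h => ⟨0, DProv.mp (DProv.ax (Ax.taut fun v hb hi => ?_)) h⟩
    simp only [hi]
    tauto
  · rintro α β ⟨j, h1⟩ ⟨k, h2⟩
    have h1' := hmono (le_max_left j k) h1
    have h2' := hmono (le_max_right j k) h2
    refine ⟨max j k, DProv.mp (DProv.mp (DProv.ax (Ax.taut fun v hb hi => ?_)) h1') h2'⟩
    simp only [hi]
    tauto
  · rintro ⟨k, h⟩
    -- An implication into ⊥ is by definition the negation of the stage.
    exact (T k).2 h
  · intro α h
    obtain ⟨k, hk, -⟩ := (hdec' α).resolve_left h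
    exact ⟨k, hk⟩
  · intro x α h
    obtain ⟨k, -, hk⟩ := (hdec' (all x α)).resolve_left h
    obtain ⟨d, hd⟩ := hk x α rfl
    exact ⟨d, fun ⟨j, hj⟩ => hboth hj hd⟩

/-! ### Closure properties of Henkin sets -/

namespace IsHenkin

variable {CS : Set Fml} {Γ : Set (Formula ℕ)}

theorem ax (hΓ : IsHenkin CS Γ) {α β : Formula ℕ} (h : Ax (imp α β)) (hα : α ∈ Γ) : β ∈ Γ :=
  hΓ.mp (hΓ.prov (DProv.ax h)) hα

theorem imp_mem (hΓ : IsHenkin CS Γ) {α β : Formula ℕ} : imp α β ∈ Γ ↔ (α ∈ Γ → β ∈ Γ) := by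
  refine ⟨hΓ.mp, fun h => ?_⟩
  by_cases hα : α ∈ Γ
  · refine hΓ.ax (Ax.taut fun v hb hi => ?_) (h hα)
    simp only [hi]
    tauto
  · refine hΓ.ax (Ax.taut fun v hb hi => ?_) (hΓ.neg hα)
    simp only [hi, hb, Formula.neg]
    tauto

theorem all_mem (hΓ : IsHenkin CS Γ) {x : ℕ} {α : Formula ℕ} (hα : α.WF) :
    all x α ∈ Γ ↔ ∀ d : ℕ, subst (single x (Sum.inr d)) α ∈ Γ := by
  refine ⟨fun h d => hΓ.ax (Ax.allElim x _ _ (freeFor_single_inr hα x d)) h, fun h => ?_⟩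
  by_contra hall
  obtain ⟨d, hd⟩ := hΓ.witness hall
  exact hd (h d)

/-- A3 adds the missing elements one at a time. -/
theorem box_mem_mono (hΓ : IsHenkin CS Γ) {t : JTerm} {X Y : Finset (ℕ ⊕ ℕ)} {α : Formula ℕ}
    (h : box t X α ∈ Γ) (hXY : X ⊆ Y) : box t Y α ∈ Γ := by
  classical
  have key : box t (X ∪ Y) α ∈ Γ := by
    clear hXY
    induction Y using Finset.induction_on with
    | empty => simpa using h
    | insert y Y _ ih =>
        by_cases hy : y ∈ X ∪ Y
        · rwa [Finset.union_insert, Finset.insert_eq_of_mem hy]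
        · rw [Finset.union_insert]
          exact hΓ.ax (Ax.a3_of_mem_iff hy fun v => Finset.mem_insert) ih
  rwa [Finset.union_eq_right.2 hXY] at key

/-- A2 drops the superfluous elements one at a time; those outside `X` are not free in `α`. -/
theorem box_mem_of_subset (hΓ : IsHenkin CS Γ) {t : JTerm} {X Y : Finset (ℕ ⊕ ℕ)}
    {α : Formula ℕ} (h : box t Y α ∈ Γ) (hXY : X ⊆ Y) (hα : ∀ v ∈ Y, v ∈ α.fv → v ∈ X) :
    box t X α ∈ Γ := by
  classical
  have key : ∀ Z : Finset (ℕ ⊕ ℕ), (∀ v ∈ Z, v ∈ α.fv → v ∈ X) → box t (X ∪ Z) α ∈ Γ →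
      box t X α ∈ Γ := by
    intro Z
    induction Z using Finset.induction_on with
    | empty => exact fun _ h => by simpa using h
    | insert y Z _ ih =>
        intro hZ h
        refine ih (fun v hv => hZ v (Finset.mem_insert_of_mem hv)) ?_
        by_cases hy : y ∈ X ∪ Z
        · rwa [Finset.union_insert, Finset.insert_eq_of_mem hy] at h
        · rw [Finset.union_insert] at h
          have hyα : y ∉ α.fv := fun h' =>
            hy (Finset.mem_union_left _ (hZ y (Finset.mem_insert_self _ _) h'))
          exact hΓ.ax (Ax.a2_of_mem_iff hy hyα fun v => Finset.mem_insert) h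
  refine key Y hα ?_
  rwa [Finset.union_eq_right.2 hXY]

/-- Only the domain elements in the subscript that occur in the formula matter. -/
theorem box_consts_mem (hΓ : IsHenkin CS Γ) {t : JTerm} {X : Finset (ℕ ⊕ ℕ)} {α : Formula ℕ}
    (hX : ∀ v ∈ X, v.isRight) (hα : α.consts ⊆ X) : box t α.consts α ∈ Γ ↔ box t X α ∈ Γ :=
  ⟨fun h => hΓ.box_mem_mono h hα, fun h => hΓ.box_mem_of_subset h hα
    fun v hv hv' => mem_consts.2 ⟨hv', hX v hv⟩⟩

/-- Evidence for `α(x)` is evidence for `α(a)`. -/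
theorem box_subst_single_mem (hΓ : IsHenkin CS Γ) {t : JTerm} {α : Formula ℕ} (hα : α.WF)
    (x a : ℕ) (h : box t α.consts α ∈ Γ) :
    box t (subst (single x (Sum.inr a)) α).consts (subst (single x (Sum.inr a)) α) ∈ Γ := by
  classical
  by_cases hx : Sum.inl x ∈ α.fv
  swap
  · rwa [subst_single_of_notMem hx]
  have hxc : Sum.inl x ∉ α.consts := by simp [mem_consts]
  obtain ⟨Y, hY⟩ : ∃ Y : Finset (ℕ ⊕ ℕ), ∀ v, v ∈ Y ↔ v = Sum.inl x ∨ v ∈ α.consts :=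
    ⟨insert (Sum.inl x) α.consts, fun v => Finset.mem_insert⟩
  have hxY : Sum.inl x ∈ Y := (hY _).2 (Or.inl rfl)
  have hαY : α.consts ⊆ Y := fun v hv => (hY v).2 (Or.inr hv)
  -- A3 adds `x` to the subscript, which makes it free in the conclusion only. So one may generalize
  -- over it, and the instantiation below reaches into the box.
  have h1 := hΓ.mp (hΓ.prov (DProv.all_imp (α := box t α.consts α) (x := x) hxc
    (DProv.ax (Ax.a3_of_mem_iff hxc hY)))) h
  have h2 := hΓ.ax (Ax.allElim x (Sum.inr a) (box t Y α)
    (freeFor_single_inr (φ := box t Y α) ⟨hα, hαY⟩ x a)) h1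
  rw [subst, restrict_single_of_mem hxY] at h2
  refine (hΓ.box_consts_mem ?_ fun v hv => ?_).2 h2
  · intro v hv
    simp only [Finset.mem_image] at hv
    obtain ⟨u, hu, rfl⟩ := hv
    rcases (hY u).1 hu with rfl | hu
    · simp [single_self]
    · rw [elim_single fun e => hxc (e ▸ hu)]
      exact (mem_consts.1 hu).2
  · rw [mem_consts, mem_fv_subst_single_inr] at hv
    simp only [Finset.mem_image]
    rcases hv with ⟨⟨h, h'⟩ | ⟨-, rfl⟩, hr⟩
    · exact ⟨v, hαY (mem_consts.2 ⟨h, hr⟩), elim_single h' _⟩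
    · exact ⟨_, hxY, single_self x _⟩

/-- Evidence for `α` gives all closed instances of `α`. -/
theorem subst_inr_mem (hΓ : IsHenkin CS Γ) {t : JTerm} (a : ℕ → ℕ) {α : Formula ℕ}
    (hα : α.WF) (h : box t α.consts α ∈ Γ) :
    subst (fun x => Sum.inr (a x)) α ∈ Γ ∧ (subst (fun x => Sum.inr (a x)) α).WF ∧
      (subst (fun x => Sum.inr (a x)) α).IsClosed := by
  -- Induction on the number of free variables, instantiating one at each step until B1 applies to a
  -- closed formula.
  generalize hk : (α.fv.filter fun v => v.isLeft).card = k
  induction k generalizing α with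
  | zero =>
      rw [Finset.card_eq_zero, Finset.filter_eq_empty_iff] at hk
      have hcl : α.IsClosed := fun x hx => hk hx rfl
      rw [subst_eq_self fun x hx => (hcl x hx).elim]
      exact ⟨hΓ.ax (Ax.b1 t _ α) h, hα, hcl⟩
  | succ k ih =>
      obtain ⟨v, hv⟩ := Finset.card_pos.1 (hk.symm ▸ Nat.succ_pos k :
        0 < (α.fv.filter fun v => v.isLeft).card)
      obtain ⟨hv, hl⟩ := Finset.mem_filter.1 hv
      rcases v with x | d
      swap
      · simp at hl
      have := ih (hα.subst_single_inr x (a x)) (hΓ.box_subst_single_mem hα x (a x) h) ?_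
      · rwa [subst_subst_single_inr, Function.update_eq_self x fun x => Sum.inr (a x)] at this
      · classical
        have e : ((subst (single x (Sum.inr (a x))) α).fv.filter fun v => v.isLeft) =
            (α.fv.filter fun v => v.isLeft).erase (Sum.inl x) := by
          ext v
          simp only [Finset.mem_filter, Finset.mem_erase, mem_fv_subst_single_inr]
          constructor
          · rintro ⟨⟨h, h'⟩ | ⟨-, rfl⟩, hl⟩
            · exact ⟨h', h, hl⟩
            · simp at hl
          · exact fun ⟨h', h, hl⟩ => ⟨Or.inl ⟨h, h'⟩, hl⟩
        rw [e, Finset.card_erase_of_mem (Finset.mem_filter.2 ⟨hv, hl⟩), hk]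
        rfl


end IsHenkin

/-! ### The canonical model -/

namespace FittingModel

variable (M : FittingModel) (w : M.W)

theorem truth_atom (n P : ℕ) (args : Fin n → ℕ ⊕ M.D) : M.Truth w (atom n P args) ↔
    ∃ d : Fin n → M.D, (args = fun i => Sum.inr (d i)) ∧ d ∈ M.I n P w := by
  rw [Truth]

theorem not_truth_bot : ¬ M.Truth w bot := by
  rw [Truth]
  exact id

theorem truth_imp (φ ψ : Formula M.D) :
    M.Truth w (imp φ ψ) ↔ (M.Truth w φ → M.Truth w ψ) := by
  rw [Truth]

theorem truth_all (x : ℕ) (φ : Formula M.D) :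
    M.Truth w (all x φ) ↔ ∀ a : M.D, M.Truth w (subst (single x (Sum.inr a)) φ) := by
  rw [Truth]

theorem truth_box (t : JTerm) (X : Finset (ℕ ⊕ M.D)) (φ : Formula M.D) :
    M.Truth w (box t X φ) ↔ w ∈ M.E t φ ∧ ∀ w' : M.W, M.R w w' → ∀ a : ℕ → M.D,
      M.Truth w' (subst (fun x => Sum.inr (a x)) φ) := by
  rw [Truth]

end FittingModel

/-- The one-world model given by a set of formulas. -/
def canonicalModel (Γ : Set (Formula ℕ)) : FittingModel where
  W := Unit
  D := ℕ
  nonempty_W := inferInstance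
  nonempty_D := inferInstance
  R := fun _ _ => True
  I := fun n P _ => {d | atom n P (fun i => Sum.inr (d i)) ∈ Γ}
  -- Free variables of `φ` stay out of the subscript, so that the evidence is uniform in them.
  E := fun t φ => {_w | box t φ.consts φ ∈ Γ}

/-- The induction is on size because instances of a body are not subformulas. For a box, its
evidence clause is already membership, up to subscript elements not occurring in the body. -/
theorem truth_canonicalModel {CS : Set Fml} {Γ : Set (Formula ℕ)} (hΓ : IsHenkin CS Γ)
    (w : Unit) {φ : Formula ℕ} (hφ : φ.WF) (hcl : φ.IsClosed) :
    (canonicalModel Γ).Truth w φ ↔ φ ∈ Γ := by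
  generalize hk : φ.size = k
  induction k using Nat.strong_induction_on generalizing φ w with
  | _ k ih =>
    subst hk
    cases φ with
    | atom n P args =>
        have h : ∀ i, ∃ d : ℕ, args i = Sum.inr d := by
          intro i
          rcases hi : args i with x | d
          · exact absurd (by simpa [fv] using ⟨i, hi⟩) (hcl x)
          · exact ⟨d, rfl⟩
        choose d hd using h
        obtain rfl : args = fun i => Sum.inr (d i) := funext hd
        refine (FittingModel.truth_atom (canonicalModel Γ) ..).trans ?_
        constructor
        · rintro ⟨d', h, h'⟩
          rw [h]
          exact h'
        · exact fun h => ⟨d, rfl, h⟩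
    | bot =>
        exact iff_of_false ((canonicalModel Γ).not_truth_bot w) hΓ.bot
    | imp φ ψ =>
        refine (FittingModel.truth_imp (canonicalModel Γ) ..).trans ?_
        rw [hΓ.imp_mem,
          ih φ.size (by simp only [size]; omega) w hφ.1 (fun x hx => hcl x (by simp [fv, hx])) rfl,
          ih ψ.size (by simp only [size]; omega) w hφ.2 (fun x hx => hcl x (by simp [fv, hx])) rfl]
    | all x φ =>
        refine (FittingModel.truth_all (canonicalModel Γ) ..).trans ?_
        rw [hΓ.all_mem (α := φ) hφ]
        refine forall_congr' fun a : ℕ => ih _ ?_ w (WF.subst_single_inr (φ := φ) hφ x a)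
          (hcl.subst_single_inr a) (size_subst ..)
        simp only [size]; omega
    | box t X φ =>
        have hX : ∀ v ∈ X, v.isRight := by
          rintro (x | d) hv
          · exact absurd hv (hcl x)
          · rfl
        refine (FittingModel.truth_box (canonicalModel Γ) ..).trans ?_
        rw [← hΓ.box_consts_mem hX hφ.2]
        -- Conversely, evidence puts every closed instance of the body into Γ, where the induction
        -- hypothesis makes it true.
        refine ⟨fun h => h.1, fun h => ⟨h, fun w' _ a => ?_⟩⟩
        obtain ⟨h1, h2, h3⟩ := hΓ.subst_inr_mem a hφ.1 h
        refine (ih _ ?_ w' h2 h3 (size_subst ..)).2 h1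
        simp only [size]; omega

theorem isFOJT45_canonicalModel {CS : Set Fml} {Γ : Set (Formula ℕ)} (hΓ : IsHenkin CS Γ) :
    (canonicalModel Γ).IsFOJT45 where
  equivalence := ⟨fun _ => trivial, fun _ => trivial, fun _ _ => trivial⟩
  evidence :=
    { app := by
        rintro t s (φ : Formula ℕ) (ψ : Formula ℕ) hφ hψ w ⟨h1, h2⟩
        have hr : ∀ v ∈ (imp φ ψ).consts, v.isRight := fun v hv => (mem_consts.1 hv).2
        -- B2 needs a common subscript: it is enlarged to the elements of the implication, then cut
        -- down to those of `ψ`.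
        have h3 := hΓ.box_mem_mono (Y := (imp φ ψ).consts) h2 fun v hv => by
          rw [mem_consts] at hv ⊢
          simp [fv, hv]
        refine (hΓ.box_consts_mem hr fun v hv => ?_).2 (hΓ.mp (hΓ.ax (Ax.b2 ..) h1) h3)
        rw [mem_consts] at hv ⊢
        simp [fv, hv]
      sum := by
        rintro t s (φ : Formula ℕ) hφ w (h | h)
        · exact hΓ.ax (Ax.b3l ..) h
        · exact hΓ.ax (Ax.b3r ..) h
      bang := by
        rintro t (φ : Formula ℕ) X hφ hr hX w h
        have hc : (box t X φ).consts = X := Finset.filter_true_of_mem hr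
        change box t.bang (box t X φ).consts (box t X φ) ∈ Γ
        rw [hc]
        exact hΓ.ax (Ax.b4 ..) (hΓ.box_mem_mono h hX)
      closure := fun t φ w w' _ h _ => h
      inst := fun t φ x a hφ w h => hΓ.box_subst_single_mem hφ x a h
      gen := by
        rintro t (φ : Formula ℕ) x hφ w h
        have hx : Sum.inl x ∉ φ.consts := by simp [mem_consts]
        have hc : (all x φ).consts = φ.consts := by
          ext v
          simp only [mem_consts, fv, Finset.mem_erase]
          refine ⟨fun h => ⟨h.1.2, h.2⟩, fun h => ⟨⟨fun e => ?_, h.1⟩, h.2⟩⟩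
          rw [e] at h
          simp at h
        change box (t.gen x) (all x φ).consts (all x φ) ∈ Γ
        rw [hc]
        exact hΓ.ax (Ax.b5 t _ x φ hx) h }
  strong := by
    rintro t (φ : Formula ℕ) hφ w h
    refine (truth_canonicalModel hΓ w (φ := box t φ.consts φ) ⟨hφ, subset_rfl⟩ fun x hx => ?_).2 h
    simp [fv, mem_consts] at hx
  query := by
    rintro t (φ : Formula ℕ) hφ w h
    have hc : (neg (box t φ.consts φ)).consts = φ.consts := by
      ext v
      simp [neg, fv, mem_consts]
    change box t.query (neg (box t φ.consts φ)).consts (neg (box t φ.consts φ)) ∈ Γ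
    rw [hc]
    -- Maximality turns missing evidence into a negated box, to which B6 applies.
    exact hΓ.ax (Ax.b6 t φ.consts φ) (hΓ.neg h)

theorem meets_canonicalModel {CS : Set Fml} {Γ : Set (Formula ℕ)} (hΓ : IsHenkin CS Γ) :
    (canonicalModel Γ).Meets CS := by
  intro c φ h
  refine Set.eq_univ_of_forall fun w => ?_
  change box _ (mapD Empty.elim φ : Formula ℕ).consts _ ∈ Γ
  rw [consts_mapD]
  have h' := hΓ.prov (DProv.mapD.2 (Provable.cs h))
  simp only [mapD, Finset.image_empty] at h'
  exact h'

end FOJT45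

/-! ### Completeness -/

theorem mainTheorem4 (CS : Set FOJT45.Fml) (hCS : FOJT45.IsConstantSpecification CS)
    (hvar : FOJT45.VariantClosed CS) (happ : FOJT45.AxiomaticallyAppropriate CS)
    (φ : FOJT45.Fml) (hφ : φ.IsClosed)
    (hvalid : ∀ M : FOJT45.FittingModel, M.IsFOJT45 → M.Meets CS → M.Valid φ) :
    FOJT45.Provable CS φ := by
  open FOJT45 Formula in
  by_contra hnp
  -- Unprovability of φ means that ¬φ is consistent, that is, ¬¬φ is unprovable.
  have hcons : ¬ DProv CS (neg (neg (mapD Empty.elim φ))) := by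
    refine fun h => hnp (DProv.mapD.1 (DProv.mp (DProv.ax (Ax.taut fun v hb hi => ?_)) h))
    simp only [hi, hb, neg]
    tauto
  obtain ⟨Γ, hΓ, hmem⟩ := exists_isHenkin hcons
  have hval := hvalid _ (isFOJT45_canonicalModel hΓ) (meets_canonicalModel hΓ) ()
  exact hΓ.bot (hΓ.mp hmem
    ((truth_canonicalModel hΓ () (wf_mapD φ _) (hφ.mapD _)).1 hval))
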